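/- Let $A_1(z)=\sum_{n=0}^{\infty}(-1)^n\,\Gamma(z+1-n)$; this series converges absolutely for every $z\in\mathbb{C}\setminus\mathbb{Z}$. Let $A$ be alternating Kurepa's function, that is $$A(z)=\int_0^{\infty}e^{-t}\,\frac{t^{z+1}-(-1)^z t}{t+1}\,dt\qquad(\operatorname{Re}z>0),\qquad (-1)^z=e^{i\pi z},$$ continued to $\operatorname{Re}z\le 0$ by means of the functional equation $A(z)=\Gamma(z+2)-A(z+1)$. Then $A_1$ is a meromorphic function on $\mathbb{C}$. It is holomorphic on $\mathbb{C}\setminus\mathbb{Z}$ and has a simple pole at every integer $m$. For every $m\in\mathbb{Z}$, $A$ is holomorphic in a punctured neighbourhood of $m$, and $$\operatorname*{res}_{z=m}A_1(z)=(-1)^{m-1}e+\operatorname*{res}_{z=m}A(z).$$ At $z=\infty$ the function $A_1$ has an essential singularity: as $z\to\infty$ through $\mathbb{C}\setminus\mathbb{Z}$, $A_1(z)$ has no limit, finite or infinite, in $\mathbb{C}\cup\{\infty\}$. (The point $\infty$ is a limit point of the poles.) -/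

import Mathlib

open Filter Topology MeasureTheory

noncomputable section

/-- The integral `∫₀^∞ e^{-t} (t^{z+1} - (-1)^z t) / (t + 1) dt` (principal values of the powers, so
that `(-1)^z = e^{iπz}`), which defines alternating Kurepa's function for `Re z > 0`. -/
def altKurepaIntegral (z : ℂ) : ℂ :=
  ∫ t in Set.Ioi (0 : ℝ),
    Complex.exp (-(t : ℂ)) * (((t : ℂ) ^ (z + 1) - (-1 : ℂ) ^ z * (t : ℂ)) / ((t : ℂ) + 1))

/-- Continuation to the left by `n` applications of `A(z) = Γ(z + 2) - A(z + 1)`, starting from the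
integral at `z + n`. -/
def altKurepaStep : ℕ → ℂ → ℂ
  | 0, z => altKurepaIntegral z
  | n + 1, z => Complex.Gamma (z + 2) - altKurepaStep n (z + 1)

/-- Alternating Kurepa's function `A`: the integral for `Re z > 0`, continued to `Re z ≤ 0` by the
functional equation `A(z) + A(z + 1) = Γ(z + 2)`. The number of steps is the least `n` for which
`Re (z + n) > 0`. -/
def altKurepa (z : ℂ) : ℂ :=
  altKurepaStep (⌊-z.re⌋ + 1).toNat z

theorem altKurepa_of_re_pos {z : ℂ} (hz : 0 < z.re) : altKurepa z = altKurepaIntegral z := by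
  have h : ⌊-z.re⌋ < 0 := Int.floor_lt.2 (by simpa using hz)
  have h0 : (⌊-z.re⌋ + 1).toNat = 0 := by omega
  rw [altKurepa, h0, altKurepaStep]

theorem altKurepa_of_re_nonpos {z : ℂ} (hz : z.re ≤ 0) :
    altKurepa z = Complex.Gamma (z + 2) - altKurepa (z + 1) := by
  have h : 0 ≤ ⌊-z.re⌋ := Int.floor_nonneg.2 (by simpa using hz)
  have h1 : ⌊-(z + 1).re⌋ = ⌊-z.re⌋ - 1 := by
    rw [← Int.floor_sub_one]
    congr 1
    simp
    ring
  have h2 : (⌊-z.re⌋ + 1).toNat = (⌊-(z + 1).re⌋ + 1).toNat + 1 := by omega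
  rw [altKurepa, h2, altKurepaStep, altKurepa]

/-- The function `A₁(z) = ∑_{n ≥ 0} (-1)^n Γ(z + 1 - n)`. Its values at the integers are not
meaningful. -/
def altKurepaOne (z : ℂ) : ℂ :=
  ∑' n : ℕ, (-1 : ℂ) ^ n * Complex.Gamma (z + 1 - n)

/-- `f` is holomorphic in a punctured neighbourhood of `a` and has residue `r` at `a`:
`(1 / 2πi) ∮_{|z - a| = ρ} f(z) dz = r` for all small `ρ > 0`. -/
def HasResidueAt (f : ℂ → ℂ) (a r : ℂ) : Prop :=
  (∀ᶠ z in 𝓝[≠] a, DifferentiableAt ℂ f z) ∧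
    ∀ᶠ ρ in 𝓝[>] (0 : ℝ), (2 * Real.pi * Complex.I)⁻¹ * (∮ z in C(a, ρ), f z) = r

/-- The residue of `f` at `a`; only meaningful at an isolated singularity (or regular point). -/
def residue (f : ℂ → ℂ) (a : ℂ) : ℂ :=
  limUnder (𝓝[>] (0 : ℝ)) fun ρ : ℝ =>
    (2 * Real.pi * Complex.I)⁻¹ * (∮ z in C(a, ρ), f z)

theorem HasResidueAt.residue_eq {f : ℂ → ℂ} {a r : ℂ} (h : HasResidueAt f a r) :
    residue f a = r :=
  (tendsto_const_nhds.congr' (h.2.mono fun _ hρ => hρ.symm)).limUnder_eq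

/-- `f` has an essential singularity at `∞`, in the sense that also covers a limit point of poles:
as `z → ∞` through the points where `f` is holomorphic, `f(z)` has no limit in the extended plane
`ℂ ∪ {∞}`, finite or infinite. -/
def HasEssentialSingularityAtInfty (f : ℂ → ℂ) : Prop :=
  ¬ ∃ L : OnePoint ℂ, Tendsto (fun z : ℂ => (f z : OnePoint ℂ))
    (Bornology.cobounded ℂ ⊓ 𝓟 {z : ℂ | AnalyticAt ℂ f z}) (𝓝 L)

end

/-! The reflection formula turns every term of the series into `-(π / sin πz) / Γ(n - z)`, so `A₁`
is `-π / sin πz` times the entire function `invGammaSum` (`altKurepaOne_eq`). At an integer the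
latter is a sum of nonnegative terms, not all zero, hence the poles are simple. Both `A₁` and `A`
solve `f(z + 1) = Γ(z + 2) - f(z)`, so `A₁ - A` changes sign under `z ↦ z + 1`, and its residues are
determined by the one at `1`. There `A` is analytic and `invGammaSum 1 = e`. At infinity, `A₁(1/2 -
N)` is up to sign a tail of a series and tends to `0`, while the poles at large integers give
arbitrarily distant points with `|A₁| ≥ 1`. -/

/-! ### Simple poles and residues -/

/-- `f` agrees near `a`, away from `a`, with `g z / (z - a)`, where `g` is analytic at `a` and
`g a = r`: at most a simple pole, with residue `r`. -/
def HasSimplePoleAt (f : ℂ → ℂ) (a r : ℂ) : Prop :=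
  ∃ g : ℂ → ℂ, AnalyticAt ℂ g a ∧ g a = r ∧ ∀ᶠ z in 𝓝[≠] a, f z = (z - a)⁻¹ * g z

theorem HasSimplePoleAt.congr {f h : ℂ → ℂ} {a r : ℂ} (hf : HasSimplePoleAt f a r)
    (hfh : ∀ᶠ z in 𝓝[≠] a, h z = f z) : HasSimplePoleAt h a r := by
  obtain ⟨g, hg, hga, hfg⟩ := hf
  refine ⟨g, hg, hga, ?_⟩
  filter_upwards [hfg, hfh] with z h1 h2
  rw [h2, h1]

theorem AnalyticAt.hasSimplePoleAt {f : ℂ → ℂ} {a : ℂ} (hf : AnalyticAt ℂ f a) :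
    HasSimplePoleAt f a 0 := by
  refine ⟨fun z => (z - a) * f z, (analyticAt_id.sub analyticAt_const).mul hf, by simp, ?_⟩
  filter_upwards [self_mem_nhdsWithin] with z hz
  have : z - a ≠ 0 := sub_ne_zero.2 hz
  field_simp

theorem HasSimplePoleAt.sub {f h : ℂ → ℂ} {a r s : ℂ} (hf : HasSimplePoleAt f a r)
    (hh : HasSimplePoleAt h a s) : HasSimplePoleAt (fun z => f z - h z) a (r - s) := by
  obtain ⟨g, hg, hga, hfg⟩ := hf
  obtain ⟨k, hk, hka, hhk⟩ := hh
  refine ⟨fun z => g z - k z, hg.sub hk, by simp only [hga, hka], ?_⟩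
  filter_upwards [hfg, hhk] with z h1 h2
  rw [h1, h2]
  ring

theorem HasSimplePoleAt.neg {f : ℂ → ℂ} {a r : ℂ} (hf : HasSimplePoleAt f a r) :
    HasSimplePoleAt (fun z => -f z) a (-r) := by
  simpa using (analyticAt_const (v := (0 : ℂ))).hasSimplePoleAt.sub hf

theorem HasSimplePoleAt.comp_add_const {f : ℂ → ℂ} {a r : ℂ} (c : ℂ)
    (hf : HasSimplePoleAt f (a + c) r) : HasSimplePoleAt (fun z => f (z + c)) a r := by
  obtain ⟨g, hg, hga, hfg⟩ := hf
  refine ⟨fun z => g (z + c), ?_, hga, ?_⟩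
  · exact AnalyticAt.fun_comp (g := g) (f := fun z => z + c) hg (analyticAt_id.add analyticAt_const)
  · have ht : Tendsto (fun z : ℂ => z + c) (𝓝[≠] a) (𝓝[≠] (a + c)) := by
      refine tendsto_nhdsWithin_of_tendsto_nhds_of_eventually_within _
        (((continuous_id.add continuous_const).tendsto a).mono_left nhdsWithin_le_nhds) ?_
      filter_upwards [self_mem_nhdsWithin] with z hz
      simpa using hz
    filter_upwards [ht.eventually hfg] with z hz
    rw [hz]
    congr 2
    ring

theorem HasSimplePoleAt.hasResidueAt {f : ℂ → ℂ} {a r : ℂ} (hf : HasSimplePoleAt f a r) :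
    HasResidueAt f a r := by
  obtain ⟨g, hg, rfl, hfg⟩ := hf
  have hgan := hg.eventually_analyticAt
  constructor
  · filter_upwards [eventually_eventually_nhdsWithin.2 hfg,
      hgan.filter_mono nhdsWithin_le_nhds, self_mem_nhdsWithin] with z h1 h2 h3
    -- Away from `a`, punctured neighbourhoods of `a` are full neighbourhoods of `z`.
    rw [isOpen_compl_singleton.nhdsWithin_eq h3] at h1
    refine DifferentiableAt.congr_of_eventuallyEq ?_ h1
    have hza : z - a ≠ 0 := sub_ne_zero.2 h3
    exact ((differentiableAt_id.sub_const a).inv hza).mul h2.differentiableAt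
  · rw [eventually_nhdsWithin_iff, Metric.eventually_nhds_iff] at hfg
    obtain ⟨ε, hε, hfg⟩ := hfg
    obtain ⟨δ, hδ, hgan⟩ := Metric.eventually_nhds_iff.1 hgan
    filter_upwards [Ioo_mem_nhdsGT (lt_min hε hδ)] with ρ hρ
    have h1 : (∮ z in C(a, ρ), f z) = ∮ z in C(a, ρ), (z - a)⁻¹ • g z := by
      refine circleIntegral.integral_congr hρ.1.le fun z hz => ?_
      have hz' : dist z a = ρ := hz
      refine hfg (by rw [hz']; exact hρ.2.trans_le (min_le_left _ _)) ?_
      rintro rfl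
      simp at hz'
      exact hρ.1.ne hz'
    have hd : DifferentiableOn ℂ g (Metric.closedBall a ρ) := fun z hz =>
      (hgan ((Metric.mem_closedBall.1 hz).trans_lt
        (hρ.2.trans_le (min_le_right _ _)))).differentiableAt.differentiableWithinAt
    rw [h1, (hd.diffContOnCl_ball subset_rfl).circleIntegral_sub_inv_smul
      (Metric.mem_ball_self hρ.1), smul_eq_mul, inv_mul_cancel_left₀ Complex.two_pi_I_ne_zero]

theorem HasSimplePoleAt.meromorphicOrderAt_eq {f : ℂ → ℂ} {a r : ℂ} (hf : HasSimplePoleAt f a r)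
    (hr : r ≠ 0) : meromorphicOrderAt f a = ((-1 : ℤ) : WithTop ℤ) := by
  obtain ⟨g, hg, rfl, hfg⟩ := hf
  have hm : MeromorphicAt f a := by
    refine MeromorphicAt.congr (f := fun z => (z - a)⁻¹ * g z) ?_ (hfg.mono fun _ h => h.symm)
    fun_prop
  rw [meromorphicOrderAt_eq_int_iff hm]
  refine ⟨g, hg, hr, ?_⟩
  filter_upwards [hfg] with z hz
  rw [hz, zpow_neg_one, smul_eq_mul]

theorem exists_int_eq_of_sin_pi_mul_eq_zero {z : ℂ} (h : Complex.sin (Real.pi * z) = 0) :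
    z ∈ Set.range ((↑) : ℤ → ℂ) := by
  obtain ⟨k, hk⟩ := Complex.sin_eq_zero_iff.1 h
  refine ⟨k, mul_left_cancel₀ (Complex.ofReal_ne_zero.2 Real.pi_ne_zero) ?_⟩
  rw [hk]
  ring

theorem eventually_notMem_range_intCast (a : ℂ) :
    ∀ᶠ z in 𝓝[≠] a, z ∉ Set.range ((↑) : ℤ → ℂ) := by
  have hc : Topology.IsClosedEmbedding ((↑) : ℤ → ℂ) := by
    simpa [Function.comp_def] using
      Complex.isometry_ofReal.isClosedEmbedding.comp Real.isClosedEmbedding_intCast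
  have hS : IsClosed (((↑) : ℤ → ℂ) '' {n | (n : ℂ) ≠ a}) := hc.isClosedMap _ (isClosed_discrete _)
  have ha : a ∉ ((↑) : ℤ → ℂ) '' {n | (n : ℂ) ≠ a} := by
    rintro ⟨n, hn, rfl⟩
    exact hn rfl
  filter_upwards [nhdsWithin_le_nhds (hS.isOpen_compl.mem_nhds ha), self_mem_nhdsWithin]
    with z h1 h2
  rintro ⟨n, rfl⟩
  exact h1 ⟨n, h2, rfl⟩

/-! ### The entire factor of `A₁` -/

/-- The entire function `∑ 1 / Γ(n - z)`. -/
noncomputable def invGammaSum (z : ℂ) : ℂ := ∑' n : ℕ, (Complex.Gamma (n - z))⁻¹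

/-- Each unit shift divides `1 / Γ` by a factor `w + k` of norm at least `2`. -/
theorem norm_inv_Gamma_add_nat_le {w : ℂ} (hw : 2 ≤ w.re) (k : ℕ) :
    ‖(Complex.Gamma (w + k))⁻¹‖ ≤ ‖(Complex.Gamma w)⁻¹‖ * (1 / 2) ^ k := by
  induction k with
  | zero => simp
  | succ k ih =>
    have h2 : 2 ≤ ‖w + k‖ := by
      refine le_trans ?_ (Complex.re_le_norm _)
      simp
      linarith [(Nat.cast_nonneg k : (0 : ℝ) ≤ k)]
    have h0 : w + k ≠ 0 := norm_pos_iff.1 (by linarith)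
    rw [Nat.cast_succ, ← add_assoc, Complex.Gamma_add_one _ h0, mul_inv, norm_mul, pow_succ,
      ← mul_assoc, mul_comm]
    refine mul_le_mul ih ?_ (norm_nonneg _) (by positivity)
    rw [norm_inv, one_div]
    exact inv_anti₀ two_pos h2

/-- Dropping the first `N ≥ R + 2` terms moves the whole disc into `Re ≥ 2`; compactness then bounds
the leading term uniformly. -/
theorem exists_norm_inv_Gamma_le (R : ℝ) : ∃ (N : ℕ) (C : ℝ), ∀ z : ℂ, ‖z‖ ≤ R → ∀ k : ℕ,
    ‖(Complex.Gamma ((k + N : ℕ) - z))⁻¹‖ ≤ C * (1 / 2) ^ k := by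
  obtain ⟨N, hN⟩ := exists_nat_ge (R + 2)
  have hc : Continuous fun z : ℂ => (Complex.Gamma (N - z))⁻¹ :=
    Complex.differentiable_one_div_Gamma.continuous.comp (continuous_const.sub continuous_id)
  obtain ⟨C, hC⟩ := (isCompact_closedBall (0 : ℂ) R).exists_bound_of_continuousOn hc.continuousOn
  refine ⟨N, C, fun z hz k => ?_⟩
  have hw : 2 ≤ ((N : ℂ) - z).re := by
    have := (Complex.re_le_norm z).trans hz
    simp
    linarith
  have h := norm_inv_Gamma_add_nat_le hw k
  rw [show ((k + N : ℕ) : ℂ) - z = N - z + k by push_cast; ring]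
  exact h.trans (mul_le_mul_of_nonneg_right (hC z (by simpa using hz)) (by positivity))

theorem summable_norm_inv_Gamma (z : ℂ) :
    Summable fun n : ℕ => ‖(Complex.Gamma (n - z))⁻¹‖ := by
  obtain ⟨N, C, h⟩ := exists_norm_inv_Gamma_le ‖z‖
  rw [← summable_nat_add_iff N]
  exact Summable.of_nonneg_of_le (fun _ => norm_nonneg _) (h z le_rfl)
    (summable_geometric_two.mul_left C)

theorem differentiable_invGammaSum : Differentiable ℂ invGammaSum := by
  intro z₀
  obtain ⟨N, C, h⟩ := exists_norm_inv_Gamma_le (‖z₀‖ + 1)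
  have hd (n : ℕ) : Differentiable ℂ fun z : ℂ => (Complex.Gamma (n - z))⁻¹ :=
    Complex.differentiable_one_div_Gamma.comp (differentiable_id.const_sub _)
  have hsplit : invGammaSum = fun z => ∑ n ∈ Finset.range N, (Complex.Gamma (n - z))⁻¹ +
      ∑' k : ℕ, (Complex.Gamma ((k + N : ℕ) - z))⁻¹ := by
    funext z
    exact ((summable_norm_inv_Gamma z).of_norm.sum_add_tsum_nat_add N).symm
  rw [hsplit]
  refine DifferentiableAt.fun_add (.fun_sum fun n _ => hd n z₀) ?_
  refine (Complex.differentiableOn_tsum_of_summable_norm (summable_geometric_two.mul_left C)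
    (fun k => (hd (k + N)).differentiableOn) (Metric.isOpen_ball (x := (0 : ℂ)) (ε := ‖z₀‖ + 1))
    fun k z hz => h z (by simpa using (mem_ball_zero_iff.1 hz).le) k).differentiableAt
    (Metric.isOpen_ball.mem_nhds (by simp))

/-! ### Reflection formula and the poles of `A₁` -/

theorem neg_one_pow_mul_Gamma_sub_nat {z : ℂ} (hz : z ∉ Set.range ((↑) : ℤ → ℂ)) (n : ℕ) :
    (-1 : ℂ) ^ n * Complex.Gamma (z + 1 - n) =
      -(Real.pi / Complex.sin (Real.pi * z)) * (Complex.Gamma (n - z))⁻¹ := by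
  have hs : Complex.sin (Real.pi * z) ≠ 0 := fun h => hz (exists_int_eq_of_sin_pi_mul_eq_zero h)
  have hG : Complex.Gamma (n - z) ≠ 0 := by
    refine Complex.Gamma_ne_zero fun m hm => hz ⟨n + m, ?_⟩
    push_cast
    linear_combination hm
  have hr := Complex.Gamma_mul_Gamma_one_sub (n - z)
  have hsin : Complex.sin (Real.pi * (n - z)) = -((-1) ^ n * Complex.sin (Real.pi * z)) := by
    rw [show (Real.pi : ℂ) * (n - z) = n * Real.pi - Real.pi * z by ring]
    simpa only [Complex.sin_neg, mul_neg] using Complex.sin_antiperiodic.nat_mul_sub_eq n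
  rw [hsin, show (1 : ℂ) - (n - z) = z + 1 - n by ring] at hr
  rw [eq_mul_inv_iff_mul_eq₀ hG, mul_assoc, mul_comm (Complex.Gamma (z + 1 - n)), hr]
  have h1 : (-1 : ℂ) ^ n ≠ 0 := pow_ne_zero _ (by norm_num)
  field_simp

theorem summable_norm_altKurepaOne {z : ℂ} (hz : z ∉ Set.range ((↑) : ℤ → ℂ)) :
    Summable fun n : ℕ => ‖(-1 : ℂ) ^ n * Complex.Gamma (z + 1 - n)‖ := by
  simp_rw [neg_one_pow_mul_Gamma_sub_nat hz, norm_mul _ (Complex.Gamma _)⁻¹]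
  exact (summable_norm_inv_Gamma z).mul_left _

theorem altKurepaOne_eq {z : ℂ} (hz : z ∉ Set.range ((↑) : ℤ → ℂ)) :
    altKurepaOne z = -(Real.pi / Complex.sin (Real.pi * z)) * invGammaSum z := by
  simp_rw [altKurepaOne, neg_one_pow_mul_Gamma_sub_nat hz, tsum_mul_left, invGammaSum]

theorem analyticAt_altKurepaOne {z : ℂ} (hz : z ∉ Set.range ((↑) : ℤ → ℂ)) :
    AnalyticAt ℂ altKurepaOne z := by
  have hs : Complex.sin (Real.pi * z) ≠ 0 := fun h => hz (exists_int_eq_of_sin_pi_mul_eq_zero h)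
  have hG := differentiable_invGammaSum.analyticAt z
  have : AnalyticAt ℂ (fun w => -(Real.pi / Complex.sin (Real.pi * w)) * invGammaSum w) z := by
    fun_prop (disch := assumption)
  refine this.congr ?_
  have hc : Continuous fun w : ℂ => Complex.sin (Real.pi * w) := by fun_prop
  filter_upwards [hc.continuousAt.eventually_ne hs] with w hw
  refine (altKurepaOne_eq ?_).symm
  rintro ⟨m, rfl⟩
  exact hw (by rw [mul_comm, Complex.sin_int_mul_pi])

theorem hasSimplePoleAt_neg_pi_div_sin (m : ℤ) :
    HasSimplePoleAt (fun z => -(Real.pi / Complex.sin (Real.pi * z))) m ((-1) ^ (m - 1)) := by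
  have hd : Differentiable ℂ fun z : ℂ => Complex.sin (Real.pi * z) := by fun_prop
  have hderiv : deriv (fun z : ℂ => Complex.sin (Real.pi * z)) m = Real.pi * (-1) ^ m := by
    have h := ((hasDerivAt_id (m : ℂ)).const_mul (Real.pi : ℂ)).csin
    have hcos : Complex.cos (Real.pi * m) = (-1) ^ m := by
      have := congrArg ((↑) : ℝ → ℂ) (Real.cos_int_mul_pi m)
      push_cast at this
      rw [mul_comm, this]
    refine h.deriv.trans ?_
    simp only [id]
    rw [hcos]
    ring
  have hpi : (Real.pi : ℂ) ≠ 0 := Complex.ofReal_ne_zero.2 Real.pi_ne_zero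
  have hm : ((-1 : ℂ)) ^ m ≠ 0 := zpow_ne_zero _ (by norm_num)
  have han : AnalyticAt ℂ (dslope (fun z : ℂ => Complex.sin (Real.pi * z)) m) m :=
    ((Complex.differentiableOn_dslope univ_mem).2 hd.differentiableOn).analyticAt univ_mem
  refine ⟨fun z => -(Real.pi / dslope (fun z : ℂ => Complex.sin (Real.pi * z)) m z),
    (analyticAt_const.div han ?_).neg, ?_, ?_⟩
  · rw [dslope_same, hderiv]
    exact mul_ne_zero hpi hm
  · simp only [dslope_same, hderiv]
    have hsq : (-1 : ℂ) ^ m * (-1) ^ m = 1 := by rw [← mul_zpow]; simp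
    rw [zpow_sub_one₀ (by norm_num)]
    field_simp
    linear_combination hsq
  · filter_upwards [self_mem_nhdsWithin] with z hz
    have hzm : z - m ≠ 0 := sub_ne_zero.2 hz
    rw [dslope_of_ne _ hz, slope_def_field, mul_comm (Real.pi : ℂ) m, Complex.sin_int_mul_pi,
      sub_zero]
    field_simp

theorem hasSimplePoleAt_altKurepaOne (m : ℤ) :
    HasSimplePoleAt altKurepaOne m ((-1) ^ (m - 1) * invGammaSum m) := by
  obtain ⟨g, hg, hgm, h⟩ := hasSimplePoleAt_neg_pi_div_sin m
  refine ⟨fun z => g z * invGammaSum z, hg.mul (differentiable_invGammaSum.analyticAt _),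
    by simp only [hgm], ?_⟩
  filter_upwards [h, eventually_notMem_range_intCast m] with z h1 h2
  rw [altKurepaOne_eq h2, h1, mul_assoc]

/-- The terms with `n ≤ m` vanish, since `Γ` takes the default value `0` at its poles; those with `n
> m` are positive. -/
theorem invGammaSum_intCast_ne_zero (m : ℤ) : invGammaSum m ≠ 0 := by
  have hterm (n : ℕ) : (Complex.Gamma (n - m))⁻¹ = (((Real.Gamma (n - m))⁻¹ : ℝ) : ℂ) := by
    push_cast [← Complex.Gamma_ofReal]
    rfl
  have hnonneg (n : ℕ) : 0 ≤ (Real.Gamma (n - m))⁻¹ := by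
    rw [inv_nonneg]
    rcases lt_or_ge m n with h | h
    · exact (Real.Gamma_pos_of_pos (sub_pos.2 (by exact_mod_cast h))).le
    · obtain ⟨k, hk⟩ := Int.eq_ofNat_of_zero_le (sub_nonneg.2 h)
      have : (n : ℝ) - m = -k := by
        have := congrArg ((↑) : ℤ → ℝ) hk
        push_cast at this
        linarith
      rw [this, Real.Gamma_neg_nat_eq_zero]
  have hs : Summable fun n : ℕ => (Real.Gamma (n - m))⁻¹ := by
    have := (summable_norm_inv_Gamma m).of_norm
    simp_rw [hterm] at this
    exact Complex.summable_ofReal.1 this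
  have hpos : 0 < (Real.Gamma ((m.toNat + 1 : ℕ) - m))⁻¹ := by
    refine inv_pos.2 (Real.Gamma_pos_of_pos (sub_pos.2 ?_))
    have : m < (m.toNat + 1 : ℕ) := by omega
    exact_mod_cast this
  simp_rw [invGammaSum, hterm, ← Complex.ofReal_tsum]
  exact Complex.ofReal_ne_zero.2 (hs.tsum_pos hnonneg _ hpos).ne'

/-- The terms `n = 0, 1` are zero, and the others are `1 / k!`. -/
theorem invGammaSum_one : invGammaSum 1 = (Real.exp 1 : ℂ) := by
  have h0 := Complex.Gamma_neg_nat_eq_zero 1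
  rw [invGammaSum, ← (summable_norm_inv_Gamma 1).of_norm.sum_add_tsum_nat_add 2,
    Complex.ofReal_exp, Complex.ofReal_one, Complex.exp_eq_exp_ℂ, NormedSpace.exp_eq_tsum_div]
  have hz : ∑ n ∈ Finset.range 2, (Complex.Gamma (n - 1))⁻¹ = 0 := by
    simpa [Finset.sum_range_succ, Complex.Gamma_zero] using h0
  rw [hz, zero_add]
  refine tsum_congr fun k => ?_
  rw [show ((k + 2 : ℕ) : ℂ) - 1 = k + 1 by push_cast; ring, Complex.Gamma_nat_eq_factorial,
    one_pow, one_div]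

/-! ### Shifts of `A₁` by integers -/

theorem altKurepaOne_sub_nat {z : ℂ} (N : ℕ) :
    altKurepaOne (z - N) =
      (-1) ^ N * ∑' n : ℕ, (-1 : ℂ) ^ (n + N) * Complex.Gamma (z + 1 - (n + N : ℕ)) := by
  rw [altKurepaOne, ← tsum_mul_left]
  refine tsum_congr fun n => ?_
  rw [← mul_assoc, ← pow_add, show N + (n + N) = n + 2 * N by ring, pow_add, pow_mul (-1 : ℂ) 2]
  push_cast
  rw [show z - N + 1 - n = z + 1 - (n + N) by ring]
  simp

/-- Tails tend to `0`; without summability they are `0` by default, so `z` is unrestricted. -/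
theorem tendsto_altKurepaOne_sub_nat {z : ℂ} :
    Tendsto (fun N : ℕ => altKurepaOne (z - N)) atTop (𝓝 0) := by
  rw [tendsto_zero_iff_norm_tendsto_zero]
  have := tendsto_sum_nat_add fun n : ℕ => (-1 : ℂ) ^ n * Complex.Gamma (z + 1 - n)
  refine (tendsto_zero_iff_norm_tendsto_zero.1 this).congr fun N => ?_
  rw [altKurepaOne_sub_nat, norm_mul, norm_pow, norm_neg, norm_one, one_pow, one_mul]

theorem altKurepaOne_add_one {z : ℂ} (hz : z ∉ Set.range ((↑) : ℤ → ℂ)) :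
    altKurepaOne (z + 1) = Complex.Gamma (z + 2) - altKurepaOne z := by
  have hz' : z + 1 ∉ Set.range ((↑) : ℤ → ℂ) := by
    rintro ⟨m, hm⟩
    exact hz ⟨m - 1, by push_cast; rw [hm]; ring⟩
  rw [altKurepaOne, (summable_norm_altKurepaOne hz').of_norm.tsum_eq_zero_add, altKurepaOne,
    sub_eq_add_neg (Complex.Gamma _), ← tsum_neg]
  congr 1
  · simp [add_assoc, one_add_one_eq_two]
  · refine tsum_congr fun n => ?_
    push_cast
    rw [show z + 1 + 1 - (n + 1 : ℂ) = z + 1 - n by ring]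
    ring

/-! ### Alternating Kurepa's function as a Mellin transform -/

theorem mellinConvergent_and_differentiableAt {s : ℂ} (hs : 0 < s.re) :
    MellinConvergent (fun t : ℝ => Complex.exp (-t) / (t + 1)) s ∧
      DifferentiableAt ℂ (mellin fun t : ℝ => Complex.exp (-t) / (t + 1)) s := by
  have hne {t : ℝ} (ht : 0 < t) : (t : ℂ) + 1 ≠ 0 := by exact_mod_cast (add_pos ht one_pos).ne'
  have hloc : LocallyIntegrableOn (fun t : ℝ => Complex.exp (-t) / (t + 1)) (Set.Ioi 0) := by
    refine ContinuousOn.locallyIntegrableOn ?_ measurableSet_Ioi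
    exact ContinuousOn.div (by fun_prop) (by fun_prop) fun t ht => hne ht
  have hbound {t : ℝ} (ht : 0 < t) : ‖Complex.exp (-t) / (t + 1)‖ ≤ Real.exp (-t) := by
    rw [norm_div, Complex.norm_exp, Complex.neg_re, Complex.ofReal_re]
    refine div_le_self (Real.exp_pos _).le ?_
    have : ‖((t + 1 : ℝ) : ℂ)‖ = t + 1 := by
      rw [Complex.norm_real, Real.norm_of_nonneg (by linarith)]
    push_cast at this
    linarith
  have htop : (fun t : ℝ => Complex.exp (-t) / (t + 1)) =O[atTop] fun t => Real.exp (-1 * t) := by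
    refine Asymptotics.IsBigO.of_bound 1 ?_
    filter_upwards [eventually_gt_atTop 0] with t ht
    simpa using hbound ht
  have hbot : (fun t : ℝ => Complex.exp (-t) / (t + 1)) =O[𝓝[>] 0] fun t : ℝ => t ^ (-(0 : ℝ)) := by
    refine Asymptotics.IsBigO.of_bound 1 ?_
    filter_upwards [self_mem_nhdsWithin] with t ht
    have ht : 0 < t := ht
    simpa using (hbound ht).trans (Real.exp_le_one_iff.2 (by linarith))
  exact ⟨mellinConvergent_of_isBigO_rpow_exp one_pos hloc htop hbot hs,
    mellin_differentiableAt_of_isBigO_rpow_exp one_pos hloc htop hbot hs⟩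

theorem altKurepaIntegral_eq {z : ℂ} (hz : 0 < z.re) :
    altKurepaIntegral z = mellin (fun t : ℝ => Complex.exp (-t) / (t + 1)) (z + 2) -
      (-1) ^ z * mellin (fun t : ℝ => Complex.exp (-t) / (t + 1)) 2 := by
  have h1 := (mellinConvergent_and_differentiableAt (s := z + 2) (by simp; linarith)).1
  have h2 := (mellinConvergent_and_differentiableAt (s := 2) (by simp)).1
  rw [mellin, mellin, ← integral_const_mul, ← integral_sub h1 (h2.const_mul _), altKurepaIntegral]
  refine setIntegral_congr_fun measurableSet_Ioi fun t _ => ?_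
  simp only [smul_eq_mul]
  rw [show z + 2 - 1 = z + 1 by ring, show (2 : ℂ) - 1 = 1 by ring, Complex.cpow_one]
  ring

theorem analyticAt_altKurepa {z : ℂ} (hz : 0 < z.re) : AnalyticAt ℂ altKurepa z := by
  rw [Complex.analyticAt_iff_eventually_differentiableAt]
  have ho : ∀ᶠ w : ℂ in 𝓝 z, 0 < w.re := Complex.continuous_re.continuousAt.eventually_const_lt hz
  filter_upwards [ho.eventually_nhds] with w hw
  have he : altKurepa =ᶠ[𝓝 w] fun z => mellin (fun t : ℝ => Complex.exp (-t) / (t + 1)) (z + 2) -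
      (-1) ^ z * mellin (fun t : ℝ => Complex.exp (-t) / (t + 1)) 2 := by
    filter_upwards [hw] with v hv
    rw [altKurepa_of_re_pos hv, altKurepaIntegral_eq hv]
  refine DifferentiableAt.congr_of_eventuallyEq ?_ he
  have hm := (mellinConvergent_and_differentiableAt (s := w + 2)
    (by simp; linarith [hw.self_of_nhds])).2
  refine DifferentiableAt.fun_sub ?_ ?_
  · exact DifferentiableAt.fun_comp' (g := mellin fun t : ℝ => Complex.exp (-t) / (t + 1))
      (f := fun v : ℂ => v + 2) w hm (differentiableAt_id.add_const 2)
  · exact (differentiableAt_id.const_cpow (Or.inl (by norm_num))).mul_const _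

/-- For `Re z > 0` the factor `1 + t` cancels the denominator, leaving Euler's integral, and the
`(-1)^z` terms cancel. -/
theorem altKurepa_add_one (z : ℂ) :
    altKurepa (z + 1) = Complex.Gamma (z + 2) - altKurepa z := by
  rcases le_or_gt z.re 0 with hz | hz
  · rw [altKurepa_of_re_nonpos hz]
    ring
  have hz1 : 0 < (z + 1).re := by simp; linarith
  have h1 := (mellinConvergent_and_differentiableAt (s := z + 2) (by simp; linarith)).1
  have h2 := (mellinConvergent_and_differentiableAt (s := z + 1 + 2) (by simp; linarith)).1
  have hG : Complex.Gamma (z + 2) = mellin (fun t : ℝ => Complex.exp (-t) / (t + 1)) (z + 2) +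
      mellin (fun t : ℝ => Complex.exp (-t) / (t + 1)) (z + 1 + 2) := by
    rw [Complex.Gamma_eq_integral (by simp; linarith), Complex.GammaIntegral, mellin, mellin,
      ← integral_add h1 h2]
    refine setIntegral_congr_fun measurableSet_Ioi fun t ht => ?_
    have ht0 : (t : ℂ) ≠ 0 := Complex.ofReal_ne_zero.2 (ne_of_gt ht)
    have ht1 : (t : ℂ) + 1 ≠ 0 := by
      exact_mod_cast (add_pos ht one_pos).ne'
    simp only [smul_eq_mul]
    rw [show z + 1 + 2 - 1 = z + 2 - 1 + 1 by ring, Complex.cpow_add _ 1 ht0, Complex.cpow_one]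
    push_cast
    field_simp
    ring
  rw [altKurepa_of_re_pos hz, altKurepa_of_re_pos hz1, altKurepaIntegral_eq hz,
    altKurepaIntegral_eq hz1, hG, Complex.cpow_add _ 1 (by norm_num), Complex.cpow_one]
  ring

/-! ### Comparison of residues -/

theorem hasSimplePoleAt_altKurepaOne_sub_altKurepa (m : ℤ) :
    HasSimplePoleAt (fun z => altKurepaOne z - altKurepa z) m
      ((-1) ^ (m - 1) * (Real.exp 1 : ℂ)) := by
  have hanti (a : ℂ) : ∀ᶠ z in 𝓝[≠] a, altKurepaOne (z + 1) - altKurepa (z + 1) =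
      -(altKurepaOne z - altKurepa z) := by
    filter_upwards [eventually_notMem_range_intCast a] with z hz
    rw [altKurepaOne_add_one hz, altKurepa_add_one]
    ring
  have hup (k : ℤ) (ih : HasSimplePoleAt (fun z => altKurepaOne z - altKurepa z) k
      ((-1) ^ (k - 1) * (Real.exp 1 : ℂ))) : HasSimplePoleAt (fun z => altKurepaOne z - altKurepa z)
      (k + 1 : ℤ) ((-1) ^ (k + 1 - 1) * (Real.exp 1 : ℂ)) := by
    have h : HasSimplePoleAt (fun z => altKurepaOne (z + -1 + 1) - altKurepa (z + -1 + 1))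
        (k + 1 : ℤ) (-((-1) ^ (k - 1) * (Real.exp 1 : ℂ))) := by
      refine HasSimplePoleAt.comp_add_const (a := ((k + 1 : ℤ) : ℂ)) (-1)
        (f := fun z => altKurepaOne (z + 1) - altKurepa (z + 1)) ?_
      rw [show ((k + 1 : ℤ) : ℂ) + -1 = k by push_cast; ring]
      exact ih.neg.congr (hanti _)
    simp only [neg_add_cancel_right] at h
    convert h using 1
    rw [show k + 1 - 1 = k - 1 + 1 by ring, zpow_add_one₀ (by norm_num)]
    ring
  have hdown (k : ℤ) (ih : HasSimplePoleAt (fun z => altKurepaOne z - altKurepa z) k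
      ((-1) ^ (k - 1) * (Real.exp 1 : ℂ))) : HasSimplePoleAt (fun z => altKurepaOne z - altKurepa z)
      (k - 1 : ℤ) ((-1) ^ (k - 1 - 1) * (Real.exp 1 : ℂ)) := by
    have h : HasSimplePoleAt (fun z => altKurepaOne (z + 1) - altKurepa (z + 1))
        (k - 1 : ℤ) ((-1) ^ (k - 1) * (Real.exp 1 : ℂ)) := by
      refine HasSimplePoleAt.comp_add_const 1 (f := fun z => altKurepaOne z - altKurepa z) ?_
      rw [show ((k - 1 : ℤ) : ℂ) + 1 = k by push_cast; ring]
      exact ih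
    convert h.neg.congr ((hanti _).mono fun z hz => ?_) using 1
    · rw [zpow_sub_one₀ (by norm_num) (k - 1)]
      ring
    · rw [hz, neg_neg]
  induction m using Int.induction_on with
  | zero =>
    -- The case `0` is reached from `1`, where the integral defines `A`.
    have h := (hasSimplePoleAt_altKurepaOne 1).sub
      (analyticAt_altKurepa (z := ((1 : ℤ) : ℂ)) (by simp)).hasSimplePoleAt
    exact hdown 1 (by simpa [invGammaSum_one] using h)
  | succ k ih => exact hup _ ih
  | pred k ih => exact hdown _ ih

theorem meromorphicOrderAt_altKurepaOne (m : ℤ) :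
    meromorphicOrderAt altKurepaOne (m : ℂ) = ((-1 : ℤ) : WithTop ℤ) :=
  (hasSimplePoleAt_altKurepaOne m).meromorphicOrderAt_eq
    (mul_ne_zero (zpow_ne_zero _ (by norm_num)) (invGammaSum_intCast_ne_zero m))

/-! ### Behaviour at infinity -/

theorem hasEssentialSingularityAtInfty_altKurepaOne :
    HasEssentialSingularityAtInfty altKurepaOne := by
  rintro ⟨L, hL⟩
  have hhalf (N : ℕ) : (1 / 2 : ℂ) - N ∉ Set.range ((↑) : ℤ → ℂ) := by
    rintro ⟨m, hm⟩
    have h2 : ((2 * (m + N) : ℤ) : ℂ) = (1 : ℤ) := by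
      push_cast
      rw [hm]
      ring
    have := Int.cast_injective h2
    omega
  have hseq : Tendsto (fun N : ℕ => (1 / 2 : ℂ) - N) atTop
      (Bornology.cobounded ℂ ⊓ 𝓟 {z : ℂ | AnalyticAt ℂ altKurepaOne z}) := by
    refine tendsto_inf.2 ⟨?_, tendsto_principal.2
      (Eventually.of_forall fun N => analyticAt_altKurepaOne (hhalf N))⟩
    rw [← tendsto_norm_atTop_iff_cobounded]
    refine tendsto_atTop_mono (fun N => ?_)
      (tendsto_atTop_add_const_right _ (-(1 / 2) : ℝ) tendsto_natCast_atTop_atTop)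
    have := norm_sub_norm_le (N : ℂ) (1 / 2)
    rw [norm_sub_rev] at this
    simp at this ⊢
    linarith
  have hL0 : L = ((0 : ℂ) : OnePoint ℂ) := tendsto_nhds_unique (hL.comp hseq)
    ((OnePoint.continuous_coe.tendsto 0).comp tendsto_altKurepaOne_sub_nat)
  rw [hL0] at hL
  have h0 : Tendsto altKurepaOne
      (Bornology.cobounded ℂ ⊓ 𝓟 {z : ℂ | AnalyticAt ℂ altKurepaOne z}) (𝓝 0) :=
    OnePoint.isOpenEmbedding_coe.isInducing.tendsto_nhds_iff.2 hL
  have h1 := eventually_inf_principal.1 (h0.norm.eventually_lt_const (u := 1) (by simp))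
  obtain ⟨R, -, hR⟩ := hasBasis_cobounded_norm.eventually_iff.1 h1
  -- The unit ball around `m` then lies in `‖z‖ ≥ R`.
  obtain ⟨m, hm⟩ := exists_nat_ge (R + 1)
  have hpole : Tendsto altKurepaOne (𝓝[≠] ((m : ℤ) : ℂ)) (Bornology.cobounded ℂ) :=
    tendsto_cobounded_of_meromorphicOrderAt_neg (by
      rw [meromorphicOrderAt_altKurepaOne]
      exact WithTop.coe_lt_coe.2 (by norm_num))
  have hbig := (tendsto_norm_atTop_iff_cobounded.2 hpole).eventually_ge_atTop 1
  obtain ⟨z, hz1, hz2, hz3⟩ := (hbig.and ((eventually_notMem_range_intCast _).and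
    (nhdsWithin_le_nhds (Metric.ball_mem_nhds _ one_pos)))).exists
  have hzR : R ≤ ‖z‖ := by
    have h := norm_sub_norm_le ((m : ℤ) : ℂ) z
    rw [dist_comm, dist_eq_norm] at hz3
    have hmn : ‖((m : ℤ) : ℂ)‖ = m := by simp
    linarith
  exact (hR hzR (analyticAt_altKurepaOne hz2)).not_ge hz1

theorem mainTheorem9 :
    (∀ z : ℂ, z ∉ Set.range ((↑) : ℤ → ℂ) →
      Summable fun n : ℕ => ‖(-1 : ℂ) ^ n * Complex.Gamma (z + 1 - n)‖) ∧
    Meromorphic altKurepaOne ∧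
    (∀ z : ℂ, z ∉ Set.range ((↑) : ℤ → ℂ) → AnalyticAt ℂ altKurepaOne z) ∧
    (∀ m : ℤ, meromorphicOrderAt altKurepaOne (m : ℂ) = ((-1 : ℤ) : WithTop ℤ)) ∧
    (∀ m : ℤ,
      HasResidueAt altKurepa (m : ℂ) (residue altKurepa (m : ℂ)) ∧
      HasResidueAt altKurepaOne (m : ℂ)
        ((-1 : ℂ) ^ (m - 1) * (Real.exp 1 : ℂ) + residue altKurepa (m : ℂ))) ∧
    HasEssentialSingularityAtInfty altKurepaOne := by
  refine ⟨fun z => summable_norm_altKurepaOne, fun z => ?_, fun z => analyticAt_altKurepaOne,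
    meromorphicOrderAt_altKurepaOne,
    fun m => ?_, hasEssentialSingularityAtInfty_altKurepaOne⟩
  · by_cases hz : z ∈ Set.range ((↑) : ℤ → ℂ)
    · obtain ⟨m, rfl⟩ := hz
      -- A non-meromorphic point has default order `0`, not `-1`.
      by_contra h
      simpa [meromorphicOrderAt_of_not_meromorphicAt h] using meromorphicOrderAt_altKurepaOne m
    · exact (analyticAt_altKurepaOne hz).meromorphicAt
  · have hA := (hasSimplePoleAt_altKurepaOne m).sub (hasSimplePoleAt_altKurepaOne_sub_altKurepa m)
    simp only [sub_sub_cancel] at hA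
    have hres := hA.hasResidueAt
    rw [hres.residue_eq]
    refine ⟨hres, ?_⟩
    convert (hasSimplePoleAt_altKurepaOne m).hasResidueAt using 1
    ring
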